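/- **Setting.** Let $T>0$, $Q_T=(-1,1)\times(0,T)$, and let $a\in C([-1,1])\cap C^1(-1,1)$ with $a>0$ on $(-1,1)$ and $a(\pm1)=0$. Let $\vartheta\ge 1$. Assume one of the following two cases. * (WDeg) $1/a\in L^1(-1,1)$, $\vartheta<4$, and the boundary conditions are the Robin conditions $$\beta_0u(-1,t)+\beta_1(au_x)(-1,t)=0,\qquad \gamma_0u(1,t)+\gamma_1(au_x)(1,t)=0,$$ where $\beta_0,\beta_1,\gamma_0,\gamma_1\in\mathbb R$, $\beta_0^2+\beta_1^2>0$, $\gamma_0^2+\gamma_1^2>0$, $\beta_0\beta_1\le0$, $\gamma_0\gamma_1\ge0$. * (SDeg) $1/a\notin L^1(-1,1)$, $\vartheta<3$, the function $\xi_a(x)=\int_0^x\frac{ds}{a(s)}$ belongs to $L^{q_\vartheta}(-1,1)$ with $q_\vartheta=\max\{\frac{1+\vartheta}{3-\vartheta},2\vartheta-1\}$, and the boundary conditions are the weighted Neumann conditions $(au_x)(\pm1,t)=0$. The boundary values of $au_x$ are its limits as $x\to\pm1$. Let $f:Q_T\times\mathbb R\to\mathbb R$ be such that $(x,t)\mapsto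 f(x,t,u)$ is measurable for every $u$ and $u\mapsto f(x,t,u)$ is continuous for a.e. $(x,t)\in Q_T$. For every $u\in\mathbb R$ and a.e. $x\in(-1,1)$, let $t\mapsto f(x,t,u)$ be locally absolutely continuous on $(0,T)$ with $f_t(x,t,u)\,u\ge-\nu u^2$ for a.e. $t\in(0,T)$. For a.e. $(x,t)\in Q_T$ and all $u,v\in\mathbb R$, let $|f(x,t,u)|\le\delta_*|u|^\vartheta$ and $$-\nu\big(1+|u|^{\vartheta-1}+|v|^{\vartheta-1}\big)(u-v)^2\le\big(f(x,t,u)-f(x,t,v)\big)(u-v)\le\nu(u-v)^2,$$ with constants $\delta_*,\nu\ge0$. Let $\alpha\in L^\infty(Q_T)$ be piecewise static: there are $0=t_0<t_1<\dots<t_m=T$ and $\alpha_1,\dots,\alpha_m\in L^\infty(-1,1)$ with $\alpha(x,t)=\alpha_1(x)\mathbf 1_{[t_0,t_1]}(t)+\sum_{k=2}^m\alpha_k(x)\mathbf 1_{(t_{k-1},t_k]}(t)$ for a.e. $(x,t)\in Q_T$. **Spaces.** $H^1_a(-1,1)$ is the set of $u\in L^2(-1,1)$ that are absolutely continuous on $[-1,1]$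 in the case (WDeg), locally absolutely continuous on $(-1,1)$ in the case (SDeg), and satisfy $\sqrt a\,u_x\in L^2(-1,1)$; its norm is given by $\|u\|_{1,a}^2=\|u\|_{L^2}^2+\|\sqrt a\,u_x\|_{L^2}^2$. $H^2_a(-1,1)$ is the set of $u\in H^1_a(-1,1)$ with $au_x\in H^1(-1,1)$. $A_0u=(au_x)_x$, where $D(A_0)$ is the set of $u\in H^2_a(-1,1)$ satisfying the Robin conditions in the case (WDeg), and $D(A_0)=H^2_a(-1,1)$ in the case (SDeg). Moreover $$\mathcal B(Q_T)=C([0,T];L^2(-1,1))\cap L^2(0,T;H^1_a(-1,1)),$$ $$\|u\|^2_{\mathcal B(Q_T)}=\sup_{t\in[0,T]}\|u(\cdot,t)\|^2_{L^2(-1,1)}+2\int_0^T\!\!\int_{-1}^1a\,u_x^2\,dx\,dt,$$ $$\mathcal H(Q_T)=L^2(0,T;D(A_0))\cap H^1(0,T;L^2(-1,1))\cap C([0,T];H^1_a(-1,1)).$$ **Solutions.** Consider the problem $$\text{(PS)}\qquad u_t-(a(x)u_x)_x=\alpha(x,t)u+f(x,t,u)\ \text{ in }Q_T,\qquad u(\cdot,0)=u_0,$$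 with the above boundary conditions. For $u_0\in H^1_a(-1,1)$, a *strict solution* is a $u\in\mathcal H(Q_T)$ that satisfies the equation a.e. in $Q_T$, the boundary conditions for a.e. $t\in(0,T)$, and $u(\cdot,0)=u_0$. For $u_0\in L^2(-1,1)$, a *strong solution* is a $u\in\mathcal B(Q_T)$ with $u(\cdot,0)=u_0$ for which there are $u_k\in\mathcal H(Q_T)$, each the strict solution with initial datum $u_k(\cdot,0)$, such that $u_k\to u$ in $\mathcal B(Q_T)$. **Proposition.** Let $u_0\in L^2(-1,1)$ with $u_0(x)\ge0$ for a.e. $x\in(-1,1)$, and let $u$ be a strong solution of (PS) with initial datum $u_0$. Then $u(x,t)\ge0$ for a.e. $(x,t)\in Q_T$. -/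

import Mathlib

open MeasureTheory Set Filter Topology
open scoped ENNReal

namespace DegParabolic

/-- Lebesgue measure on the space interval `(-1,1)`. -/
noncomputable abbrev spaceMeasure : Measure ℝ := volume.restrict (Ioo (-1) 1)

/-- Lebesgue measure on the time interval `(0,T)`. -/
noncomputable abbrev timeMeasure (T : ℝ) : Measure ℝ := volume.restrict (Ioo 0 T)

/-- Lebesgue measure on the cylinder `Q_T = (-1,1) × (0,T)`; points are written `(x,t)`. -/
noncomputable abbrev cylMeasure (T : ℝ) : Measure (ℝ × ℝ) :=
  volume.restrict (Ioo (-1) 1 ×ˢ Ioo 0 T)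

/-- `w` is locally absolutely continuous on the open interval `(l,r)`: absolutely continuous on
each compact subinterval. -/
def LocallyAC (w : ℝ → ℝ) (l r : ℝ) : Prop :=
  ∀ c d : ℝ, l < c → c ≤ d → d < r → AbsolutelyContinuousOnInterval w c d

/-! ### The data of the problem -/

/-- Boundary conditions: the Robin conditions with coefficients `β₀, β₁` at `x = -1` and
`γ₀, γ₁` at `x = 1`, or the weighted Neumann conditions. -/
inductive BoundaryCondition where
  | robin (β₀ β₁ γ₀ γ₁ : ℝ) : BoundaryCondition
  | neumann : BoundaryCondition

/-- `1/a ∈ L¹(-1,1)`. -/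
def InvIntegrable (a : ℝ → ℝ) : Prop :=
  Integrable (fun x => 1 / a x) spaceMeasure

/-- The exponent `q_ϑ = max {(1+ϑ)/(3-ϑ), 2ϑ-1}`. -/
noncomputable def qExponent (ϑ : ℝ) : ℝ := max ((1 + ϑ) / (3 - ϑ)) (2 * ϑ - 1)

/-- The assumption (Deg) on the diffusion coefficient `a`, the growth exponent `ϑ` and the boundary
conditions: the weakly degenerate case (`1/a ∈ L¹`, `ϑ < 4`) goes with Robin conditions, the
strongly degenerate case (`1/a ∉ L¹`, `ϑ < 3`) with weighted Neumann conditions. -/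
structure Deg (a : ℝ → ℝ) (ϑ : ℝ) (bc : BoundaryCondition) : Prop where
  continuousOn : ContinuousOn a (Icc (-1) 1)
  contDiffOn : ContDiffOn ℝ 1 a (Ioo (-1) 1)
  pos : ∀ x ∈ Ioo (-1 : ℝ) 1, 0 < a x
  left : a (-1) = 0
  right : a 1 = 0
  one_le : 1 ≤ ϑ
  cases :
    match bc with
    | .robin β₀ β₁ γ₀ γ₁ =>
        InvIntegrable a ∧ ϑ < 4 ∧
          0 < β₀ ^ 2 + β₁ ^ 2 ∧ 0 < γ₀ ^ 2 + γ₁ ^ 2 ∧ β₀ * β₁ ≤ 0 ∧ 0 ≤ γ₀ * γ₁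
    | .neumann =>
        ¬ InvIntegrable a ∧ ϑ < 3 ∧
          MemLp (fun x => ∫ s in (0 : ℝ)..x, 1 / a s) (ENNReal.ofReal (qExponent ϑ)) spaceMeasure

/-- The assumption (SL) on the nonlinearity `f(x,t,u)`, with constants `ϑ`, `δ`, `ν`. -/
structure SL (f : ℝ → ℝ → ℝ → ℝ) (T ϑ δ ν : ℝ) : Prop where
  measurable : ∀ u : ℝ, AEMeasurable (fun p : ℝ × ℝ => f p.1 p.2 u) (cylMeasure T)
  continuous : ∀ᵐ p ∂(cylMeasure T), Continuous (fun u => f p.1 p.2 u)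
  locallyAC : ∀ u : ℝ, ∀ᵐ x ∂spaceMeasure, LocallyAC (fun t => f x t u) 0 T
  timeDeriv : ∀ u : ℝ, ∀ᵐ x ∂spaceMeasure, ∀ᵐ t ∂(timeMeasure T),
    -ν * u ^ 2 ≤ deriv (fun s => f x s u) t * u
  delta_nonneg : 0 ≤ δ
  nu_nonneg : 0 ≤ ν
  growth : ∀ᵐ p ∂(cylMeasure T), ∀ u : ℝ, |f p.1 p.2 u| ≤ δ * |u| ^ ϑ
  oneSided : ∀ᵐ p ∂(cylMeasure T), ∀ u v : ℝ,
    -ν * (1 + |u| ^ (ϑ - 1) + |v| ^ (ϑ - 1)) * (u - v) ^ 2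
        ≤ (f p.1 p.2 u - f p.1 p.2 v) * (u - v) ∧
      (f p.1 p.2 u - f p.1 p.2 v) * (u - v) ≤ ν * (u - v) ^ 2

/-- `α ∈ L^∞(Q_T)` is piecewise static: for a partition `0 = τ 0 < τ 1 < ⋯ < τ m = T` it is given
by bounded functions of `x` alone, `A k` being its value for times between `τ k` and
`τ (k + 1)`. -/
def PiecewiseStatic (α : ℝ → ℝ → ℝ) (T : ℝ) : Prop :=
  ∃ (m : ℕ) (τ : ℕ → ℝ) (A : ℕ → ℝ → ℝ),
    τ 0 = 0 ∧ τ m = T ∧ (∀ k < m, τ k < τ (k + 1)) ∧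
    (∀ k < m, MemLp (A k) ∞ spaceMeasure) ∧
    ∀ᵐ p ∂(cylMeasure T), α p.1 p.2 =
      A 0 p.1 * (Icc (τ 0) (τ 1)).indicator 1 p.2 +
        ∑ k ∈ Finset.Ico 1 m, A k p.1 * (Ioc (τ k) (τ (k + 1))).indicator 1 p.2

/-! ### Weighted Sobolev spaces on `(-1,1)` -/

/-- `w ∈ H¹_a(-1,1)`. The functions are absolutely continuous (on `[-1,1]` in the weakly degenerate
case, locally on `(-1,1)` in the strongly degenerate case), so `deriv w` is their a.e. defined
derivative. -/
structure MemH1a (a w : ℝ → ℝ) : Prop where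
  memLp : MemLp w 2 spaceMeasure
  ac_weak : InvIntegrable a → AbsolutelyContinuousOnInterval w (-1) 1
  ac_strong : ¬ InvIntegrable a → LocallyAC w (-1) 1
  deriv_memLp : MemLp (fun x => √(a x) * deriv w x) 2 spaceMeasure

/-- The flux `a wₓ`. -/
noncomputable def flux (a w : ℝ → ℝ) (x : ℝ) : ℝ := a x * deriv w x

/-- `w ∈ H²_a(-1,1)`: `w ∈ H¹_a(-1,1)` and `a wₓ ∈ H¹(-1,1)`, that is, `a wₓ` agrees a.e. with an
absolutely continuous function on `[-1,1]` whose derivative is in `L²(-1,1)`. -/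
def MemH2a (a w : ℝ → ℝ) : Prop :=
  MemH1a a w ∧ ∃ p : ℝ → ℝ, AbsolutelyContinuousOnInterval p (-1) 1 ∧
    MemLp (deriv p) 2 spaceMeasure ∧ flux a w =ᵐ[spaceMeasure] p

/-- The boundary conditions for `w`. The boundary values of `a wₓ` at `x = ±1` are the
one-sided limits (they exist for `w ∈ H²_a`). -/
def BoundaryCondition.Holds (bc : BoundaryCondition) (a w : ℝ → ℝ) : Prop :=
  match bc with
  | .robin β₀ β₁ γ₀ γ₁ =>
      (∃ l : ℝ, Tendsto (flux a w) (𝓝[>] (-1)) (𝓝 l) ∧ β₀ * w (-1) + β₁ * l = 0) ∧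
      (∃ r : ℝ, Tendsto (flux a w) (𝓝[<] 1) (𝓝 r) ∧ γ₀ * w 1 + γ₁ * r = 0)
  | .neumann =>
      Tendsto (flux a w) (𝓝[>] (-1)) (𝓝 0) ∧ Tendsto (flux a w) (𝓝[<] 1) (𝓝 0)

/-- `w ∈ D(A₀)`, where `A₀ w = (a wₓ)ₓ`: the functions of `H²_a` that satisfy the Robin conditions
in the weakly degenerate case, and all of `H²_a` in the strongly degenerate case. -/
def MemDA0 (a : ℝ → ℝ) (bc : BoundaryCondition) (w : ℝ → ℝ) : Prop :=
  MemH2a a w ∧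
    match bc with
    | .robin β₀ β₁ γ₀ γ₁ => (BoundaryCondition.robin β₀ β₁ γ₀ γ₁).Holds a w
    | .neumann => True

/-! ### Spaces involving time -/

/-- `t ↦ w(·,t)` is continuous on `[0,T]` for the norm of `L²(-1,1)`. -/
def ContinuousL2 (T : ℝ) (w : ℝ → ℝ → ℝ) : Prop :=
  ∀ s ∈ Icc 0 T, Tendsto (fun t => eLpNorm (fun x => w x t - w x s) 2 spaceMeasure)
    (𝓝[Icc 0 T] s) (𝓝 0)

/-- `uₜ` is the derivative of `u ∈ H¹(0,T;L²(-1,1))`: it is in `L²(Q_T) = L²(0,T;L²(-1,1))` and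
`u(·,t) = u(·,0) + ∫₀ᵗ uₜ(·,s) ds` in `L²(-1,1)` for all `t ∈ [0,T]`. -/
def IsTimeDeriv (T : ℝ) (u ut : ℝ → ℝ → ℝ) : Prop :=
  MemLp (Function.uncurry ut) 2 (cylMeasure T) ∧
    ∀ t ∈ Icc 0 T, ∀ᵐ x ∂spaceMeasure, u x t = u x 0 + ∫ s in (0 : ℝ)..t, ut x s

/-- `u ∈ 𝓗(Q_T) = L²(0,T;D(A₀)) ∩ H¹(0,T;L²(-1,1)) ∩ C([0,T];H¹_a(-1,1))`. Spaces
`L²(0,T;L²(-1,1))` are identified with `L²(Q_T)`; `u(·,t)` is the absolutely continuous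
representative for each `t`. -/
structure MemH (a : ℝ → ℝ) (bc : BoundaryCondition) (T : ℝ) (u : ℝ → ℝ → ℝ) : Prop where
  memH1a : ∀ t ∈ Icc 0 T, MemH1a a (fun x => u x t)
  cont : ContinuousL2 T u
  cont_deriv : ContinuousL2 T (fun x t => √(a x) * deriv (fun y => u y t) x)
  exists_timeDeriv : ∃ ut, IsTimeDeriv T u ut
  memDA0 : ∀ᵐ t ∂(timeMeasure T), MemDA0 a bc (fun x => u x t)
  memLp : MemLp (fun p : ℝ × ℝ => u p.1 p.2) 2 (cylMeasure T)
  deriv_memLp :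
    MemLp (fun p : ℝ × ℝ => √(a p.1) * deriv (fun y => u y p.2) p.1) 2 (cylMeasure T)
  flux_memLp :
    MemLp (fun p : ℝ × ℝ => deriv (flux a (fun y => u y p.2)) p.1) 2 (cylMeasure T)

/-- `u ∈ 𝓑(Q_T) = C([0,T];L²(-1,1)) ∩ L²(0,T;H¹_a(-1,1))`, with space derivative `ux`. Here `u` is
any measurable representative, so `u(·,t)` only has to agree a.e. with a member of `H¹_a`. -/
structure MemB (a : ℝ → ℝ) (T : ℝ) (u ux : ℝ → ℝ → ℝ) : Prop where
  memL2 : ∀ t ∈ Icc 0 T, MemLp (fun x => u x t) 2 spaceMeasure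
  cont : ContinuousL2 T u
  memLp : MemLp (fun p : ℝ × ℝ => u p.1 p.2) 2 (cylMeasure T)
  memH1a : ∀ᵐ t ∂(timeMeasure T), ∃ v : ℝ → ℝ, MemH1a a v ∧
    (fun x => u x t) =ᵐ[spaceMeasure] v ∧ (fun x => ux x t) =ᵐ[spaceMeasure] deriv v
  deriv_memLp : MemLp (fun p : ℝ × ℝ => √(a p.1) * ux p.1 p.2) 2 (cylMeasure T)

/-- The square of the norm of `𝓑(Q_T)` for `w` with space derivative `wx`. -/
noncomputable def normBSq (a : ℝ → ℝ) (T : ℝ) (w wx : ℝ → ℝ → ℝ) : ℝ≥0∞ :=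
  (⨆ t ∈ Icc 0 T, eLpNorm (fun x => w x t) 2 spaceMeasure ^ 2) +
    2 * ∫⁻ p, ENNReal.ofReal (a p.1 * wx p.1 p.2 ^ 2) ∂(cylMeasure T)

/-! ### Solutions -/

/-- `u` is a strict solution of `uₜ - (a uₓ)ₓ = α u + f(x,t,u)` in `Q_T` with the given boundary
conditions and initial datum `u₀ ∈ H¹_a(-1,1)`. -/
structure IsStrictSolution (a : ℝ → ℝ) (bc : BoundaryCondition) (T : ℝ) (α : ℝ → ℝ → ℝ)
    (f : ℝ → ℝ → ℝ → ℝ) (u₀ : ℝ → ℝ) (u : ℝ → ℝ → ℝ) : Prop where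
  initial_memH1a : MemH1a a u₀
  memH : MemH a bc T u
  equation : ∃ ut, IsTimeDeriv T u ut ∧ ∀ᵐ p ∂(cylMeasure T),
    ut p.1 p.2 - deriv (flux a (fun y => u y p.2)) p.1 =
      α p.1 p.2 * u p.1 p.2 + f p.1 p.2 (u p.1 p.2)
  boundary : ∀ᵐ t ∂(timeMeasure T), bc.Holds a (fun x => u x t)
  initial : ∀ x ∈ Ioo (-1 : ℝ) 1, u x 0 = u₀ x

/-- `u ∈ 𝓑(Q_T)` is a strong solution with initial datum `u₀ ∈ L²(-1,1)`: `u(·,0) = u₀`, and `u` is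
the limit in `𝓑(Q_T)` of strict solutions `uₖ` (with initial data `uₖ(·,0)`). -/
def IsStrongSolution (a : ℝ → ℝ) (bc : BoundaryCondition) (T : ℝ) (α : ℝ → ℝ → ℝ)
    (f : ℝ → ℝ → ℝ → ℝ) (u₀ : ℝ → ℝ) (u : ℝ → ℝ → ℝ) : Prop :=
  MemLp u₀ 2 spaceMeasure ∧ (fun x => u x 0) =ᵐ[spaceMeasure] u₀ ∧
    ∃ ux : ℝ → ℝ → ℝ, MemB a T u ux ∧
      ∃ uk : ℕ → ℝ → ℝ → ℝ,
        (∀ k, IsStrictSolution a bc T α f (fun x => uk k x 0) (uk k)) ∧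
        Tendsto (fun k => normBSq a T (fun x t => uk k x t - u x t)
          (fun x t => deriv (fun y => uk k y t) x - ux x t)) atTop (𝓝 0)

end DegParabolic

namespace DegParabolic

/-! Write w⁻ = max(-w, 0) and test the equation of a strict solution w with w⁻: the derivative of ∫
(w⁻)² is -2 ∫ w⁻ wₜ (`IsTimeDeriv.energy_identity`). Integrating by parts, ∫ (a wₓ)ₓ w⁻ ≥ 0, since a
wₓ (w⁻)ₓ ≤ 0 and the boundary terms have the right sign (`integral_deriv_flux_mul_negPart_nonneg`).
The reaction contributes at most 2(K + ν)(w⁻)², where |α| ≤ K, because f vanishes at u = 0 and is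
one-sided Lipschitz. Grönwall's inequality then bounds ∫ (w⁻)² at time t by exp(2(K + ν)t) times its
initial value (`IsStrictSolution.integral_negPart_sq_le`).

The strict solutions approximating u may start with negative values, but their initial data converge
in L² to u₀ ≥ 0, so their initial negative parts tend to 0. The estimate passes to the limit at each
time (`IsStrongSolution.ae_nonneg`), and Tonelli's theorem turns this into a statement on the
cylinder. -/

/-! ### Integration by parts in space and the sign of the diffusion term. -/

theorem _root_.AbsolutelyContinuousOnInterval.lipschitz_comp {G w : ℝ → ℝ} {c d : ℝ}
    (hw : AbsolutelyContinuousOnInterval w c d) (hG : LipschitzWith 1 G) :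
    AbsolutelyContinuousOnInterval (fun x => G (w x)) c d := by
  refine squeeze_zero (fun E => Finset.sum_nonneg fun i _ => dist_nonneg) (fun E => ?_) hw
  refine Finset.sum_le_sum fun i _ => ?_
  simpa using hG.dist_le_mul (w (E.2 i).1) (w (E.2 i).2)

/-- The difference quotients of w and G ∘ w have opposite signs. No chain rule is needed, so G may
have kinks; at points of non-differentiability `deriv` is 0. -/
theorem deriv_mul_deriv_comp_nonpos {G : ℝ → ℝ} (hG : Antitone G) (w : ℝ → ℝ) (x : ℝ) :
    deriv w x * deriv (fun y => G (w y)) x ≤ 0 := by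
  by_cases h1 : DifferentiableAt ℝ w x
  · by_cases h2 : DifferentiableAt ℝ (fun y => G (w y)) x
    · have := (hasDerivAt_iff_tendsto_slope.1 h1.hasDerivAt).mul
        (hasDerivAt_iff_tendsto_slope.1 h2.hasDerivAt)
      refine le_of_tendsto this (Eventually.of_forall fun y => ?_)
      simp only [slope_def_field]
      rw [div_mul_div_comm]
      refine div_nonpos_of_nonpos_of_nonneg ?_ (mul_self_nonneg _)
      rcases le_total (w y) (w x) with h | h
      · exact mul_nonpos_of_nonpos_of_nonneg (by linarith) (by linarith [hG h])
      · exact mul_nonpos_of_nonneg_of_nonpos (by linarith) (by linarith [hG h])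
    · simp [deriv_zero_of_not_differentiableAt h2]
  · simp [deriv_zero_of_not_differentiableAt h1]

/-- Almost everywhere w' = p/a, which is continuous inside the interval; so w is locally a primitive
of p/a and the identity holds at every point. Equality everywhere is what allows differentiating the
flux and taking its boundary limits. -/
theorem flux_eq_of_ae_eq {a w p : ℝ → ℝ} (ha : ContinuousOn a (Icc (-1) 1))
    (hpos : ∀ x ∈ Ioo (-1 : ℝ) 1, 0 < a x) (hw : LocallyAC w (-1) 1)
    (hp : AbsolutelyContinuousOnInterval p (-1) 1) (hflux : flux a w =ᵐ[spaceMeasure] p) :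
    ∀ x ∈ Ioo (-1 : ℝ) 1, flux a w x = p x := by
  intro x hx
  obtain ⟨c, hc1, hcx⟩ := exists_between hx.1
  obtain ⟨d, hxd, hd1⟩ := exists_between hx.2
  have hsub : Icc c d ⊆ Ioo (-1 : ℝ) 1 := fun y hy => ⟨hc1.trans_le hy.1, hy.2.trans_lt hd1⟩
  have hpc : ContinuousOn p (Icc (-1) 1) := by
    simpa [uIcc_of_le (show (-1 : ℝ) ≤ 1 by norm_num)] using hp.continuousOn
  have hcont : ContinuousOn (fun y => p y / a y) (Ioo (-1) 1) :=
    (hpc.mono Ioo_subset_Icc_self).div (ha.mono Ioo_subset_Icc_self) fun y hy => (hpos y hy).ne'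
  have hder : ∀ᵐ y, y ∈ Ioo (-1 : ℝ) 1 → deriv w y = p y / a y := by
    have := (ae_restrict_iff' measurableSet_Ioo).1 hflux
    filter_upwards [this] with y hy hy'
    rw [eq_div_iff (hpos y hy').ne', ← hy hy', flux, mul_comm]
  have hrep : ∀ y ∈ Ioo c d, w y = w c + ∫ s in c..y, p s / a s := by
    intro y hy
    have h1 := (hw c y hc1 hy.1.le (hy.2.trans hd1)).integral_deriv_eq_sub
    rw [intervalIntegral.integral_congr_ae (g := fun s => p s / a s)] at h1
    · linarith
    · filter_upwards [hder] with s hs hs'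
      rw [uIoc_of_le hy.1.le] at hs'
      exact hs (hsub ⟨hs'.1.le, hs'.2.trans hy.2.le⟩)
  have hD : HasDerivAt (fun y => w c + ∫ s in c..y, p s / a s) (p x / a x) x := by
    refine HasDerivAt.const_add _ (intervalIntegral.integral_hasDerivAt_right ?_ ?_ ?_)
    · refine (hcont.mono ?_).intervalIntegrable
      rw [uIcc_of_le hcx.le]
      exact fun y hy => hsub ⟨hy.1, hy.2.trans hxd.le⟩
    · exact hcont.stronglyMeasurableAtFilter isOpen_Ioo x hx
    · exact hcont.continuousAt (isOpen_Ioo.mem_nhds hx)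
  have hD' : HasDerivAt w (p x / a x) x :=
    hD.congr_of_eventuallyEq (eventually_of_mem (Ioo_mem_nhds hcx hxd) hrep)
  rw [flux, hD'.deriv, mul_div_cancel₀ _ (hpos x hx).ne']

theorem LocallyAC.continuousOn {w : ℝ → ℝ} {l r : ℝ} (hw : LocallyAC w l r) :
    ContinuousOn w (Ioo l r) := by
  intro x hx
  obtain ⟨c, hc1, hcx⟩ := exists_between hx.1
  obtain ⟨d, hxd, hd1⟩ := exists_between hx.2
  have h := (hw c d hc1 (hcx.trans hxd).le hd1).continuousOn
  rw [uIcc_of_le (hcx.trans hxd).le] at h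
  exact (h.continuousAt (Icc_mem_nhds hcx hxd)).continuousWithinAt

theorem MemH1a.locallyAC {a w : ℝ → ℝ} (h : MemH1a a w) : LocallyAC w (-1) 1 := by
  by_cases hi : InvIntegrable a
  · intro c d hc hcd hd
    refine (h.ac_weak hi).mono ?_
    rw [uIcc_of_le hcd, uIcc_of_le (by norm_num)]
    exact Icc_subset_Icc hc.le hd.le
  · exact h.ac_strong hi

/-- Integration by parts against a bounded decreasing function of `w`, on a compact subinterval. -/
theorem flux_comp_sub_le_integral {a w p G : ℝ → ℝ} {c d : ℝ} (hcd : c ≤ d)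
    (hpos : ∀ x ∈ Icc c d, 0 ≤ a x) (hw : AbsolutelyContinuousOnInterval w c d)
    (hp : AbsolutelyContinuousOnInterval p c d) (hflux : ∀ x ∈ Icc c d, flux a w x = p x)
    (hG : LipschitzWith 1 G) (hG' : Antitone G) :
    p d * G (w d) - p c * G (w c) ≤ ∫ x in c..d, deriv p x * G (w x) := by
  have h := hp.integral_mul_deriv_eq_deriv_mul (hw.lipschitz_comp hG)
  have h2 : ∫ x in c..d, p x * deriv (fun x => G (w x)) x ≤ 0 := by
    rw [intervalIntegral.integral_of_le hcd]
    refine setIntegral_nonpos measurableSet_Ioc fun x hx => ?_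
    replace hx := Ioc_subset_Icc_self hx
    rw [← hflux x hx, flux, mul_assoc]
    exact mul_nonpos_of_nonneg_of_nonpos (hpos x hx) (deriv_mul_deriv_comp_nonpos hG' w x)
  linarith

/-- Integrate by parts on [c, d] inside (-1,1) and let the endpoints tend to ±1. As p' is integrable
and G bounded, the primitive of p' G(w) is continuous up to ±1. Splitting at 0 separates the two
limits. -/
theorem integral_deriv_mul_comp_nonneg {a w p G : ℝ → ℝ} {M l r : ℝ}
    (hpos : ∀ x ∈ Ioo (-1 : ℝ) 1, 0 < a x) (hw : LocallyAC w (-1) 1)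
    (hp : AbsolutelyContinuousOnInterval p (-1) 1) (hflux : ∀ x ∈ Ioo (-1 : ℝ) 1, flux a w x = p x)
    (hG : LipschitzWith 1 G) (hG' : Antitone G) (hM : ∀ s, |G s| ≤ M)
    (hl : Tendsto (fun x => flux a w x * G (w x)) (𝓝[>] (-1)) (𝓝 l)) (hl0 : l ≤ 0)
    (hr : Tendsto (fun x => flux a w x * G (w x)) (𝓝[<] 1) (𝓝 r)) (hr0 : 0 ≤ r) :
    0 ≤ ∫ x, deriv p x * G (w x) ∂spaceMeasure := by
  have hle : (-1 : ℝ) ≤ 1 := by norm_num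
  have hint : IntervalIntegrable (fun x => deriv p x * G (w x)) volume (-1) 1 := by
    have h1 := hp.intervalIntegrable_deriv
    rw [intervalIntegrable_iff_integrableOn_Ioo_of_le hle] at h1 ⊢
    refine h1.mul_bdd (c := M) ?_ (Eventually.of_forall fun x => hM _)
    exact (hG.continuous.comp_continuousOn hw.continuousOn).aestronglyMeasurable measurableSet_Ioo
  have hsub : ∀ c d : ℝ, -1 < c → c ≤ d → d < 1 →
      flux a w d * G (w d) - flux a w c * G (w c) ≤ ∫ x in c..d, deriv p x * G (w x) := by
    intro c d hc hcd hd
    have hs : Icc c d ⊆ Ioo (-1 : ℝ) 1 := fun y hy => ⟨hc.trans_le hy.1, hy.2.trans_lt hd⟩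
    rw [hflux d (hs ⟨hcd, le_rfl⟩), hflux c (hs ⟨le_rfl, hcd⟩)]
    refine flux_comp_sub_le_integral hcd (fun x hx => (hpos x (hs hx)).le) (hw c d hc hcd hd)
      (hp.mono ?_) (fun x hx => hflux x (hs hx)) hG hG'
    rw [uIcc_of_le hcd, uIcc_of_le hle]
    exact hs.trans Ioo_subset_Icc_self
  have h0 : (0 : ℝ) ∈ uIcc (-1 : ℝ) 1 := by rw [uIcc_of_le hle]; constructor <;> norm_num
  have hcont : ContinuousOn (fun y => ∫ x in (0 : ℝ)..y, deriv p x * G (w x)) (Icc (-1) 1) := by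
    have := intervalIntegral.continuousOn_primitive_interval' hint h0
    rwa [uIcc_of_le hle] at this
  have hR : r - flux a w 0 * G (w 0) ≤ ∫ x in (0 : ℝ)..1, deriv p x * G (w x) := by
    refine le_of_tendsto_of_tendsto (hr.sub_const _)
      ((hcont 1 (right_mem_Icc.2 hle)).mono_of_mem_nhdsWithin
        (mem_of_superset (Ioo_mem_nhdsLT (show (-1 : ℝ) < 1 by norm_num)) Ioo_subset_Icc_self)) ?_
    filter_upwards [Ioo_mem_nhdsLT (show (0 : ℝ) < 1 by norm_num)] with d hd
    exact hsub 0 d (by norm_num) hd.1.le hd.2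
  have hL : flux a w 0 * G (w 0) - l ≤ -∫ x in (0 : ℝ)..(-1), deriv p x * G (w x) := by
    refine le_of_tendsto_of_tendsto (hl.const_sub _)
      ((hcont (-1) (left_mem_Icc.2 hle)).mono_of_mem_nhdsWithin
        (mem_of_superset (Ioo_mem_nhdsGT (show (-1 : ℝ) < 1 by norm_num)) Ioo_subset_Icc_self)).neg ?_
    filter_upwards [Ioo_mem_nhdsGT (show (-1 : ℝ) < 0 by norm_num)] with c hc
    rw [Pi.neg_apply, ← intervalIntegral.integral_symm]
    exact hsub c 0 hc.1 hc.2.le (by norm_num)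
  have hsum := intervalIntegral.integral_add_adjacent_intervals
    (hint.mono_set (uIcc_subset_uIcc left_mem_uIcc h0))
    (hint.mono_set (uIcc_subset_uIcc h0 right_mem_uIcc))
  rw [intervalIntegral.integral_symm] at hL
  rw [← integral_Ioc_eq_integral_Ioo, ← intervalIntegral.integral_of_le hle, ← hsum]
  linarith

/-- If β₁ = 0 the condition would force wl = 0. Otherwise multiply it by β₁: β₁² l = -(β₀ β₁) wl. -/
theorem nonpos_of_robin {β₀ β₁ l wl : ℝ} (h : 0 < β₀ ^ 2 + β₁ ^ 2) (hβ : β₀ * β₁ ≤ 0)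
    (hbc : β₀ * wl + β₁ * l = 0) (hw : wl < 0) : l ≤ 0 := by
  have h1 : β₁ ≠ 0 := by
    rintro rfl
    have : β₀ ≠ 0 := by rintro rfl; simp at h
    simp [this] at hbc
    exact hw.ne hbc
  have h2 : 0 < β₁ ^ 2 := by positivity
  have h3 : β₁ ^ 2 * l = -(β₀ * β₁) * wl := by linear_combination β₁ * hbc
  by_contra! hl
  have := mul_pos h2 hl
  nlinarith

/-- The boundary terms have a favourable sign for a function `G` with `G = 0` on `[0,∞)`. -/
theorem BoundaryCondition.Holds.boundary_terms {a w G : ℝ → ℝ} {ϑ M : ℝ} {bc : BoundaryCondition}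
    (hdeg : Deg a ϑ bc) (hw : MemH1a a w) (hbc : bc.Holds a w) (hG : Continuous G)
    (hM : ∀ s, |G s| ≤ M) (hG0 : ∀ s, 0 ≤ G s) (hG1 : ∀ s, 0 ≤ s → G s = 0) :
    (∃ l ≤ 0, Tendsto (fun x => flux a w x * G (w x)) (𝓝[>] (-1)) (𝓝 l)) ∧
    (∃ r ≥ 0, Tendsto (fun x => flux a w x * G (w x)) (𝓝[<] 1) (𝓝 r)) := by
  have hle : (-1 : ℝ) ≤ 1 := by norm_num
  cases bc with
  | robin β₀ β₁ γ₀ γ₁ =>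
    obtain ⟨hi, -, hβ, hγ, hβ', hγ'⟩ := hdeg.cases
    obtain ⟨⟨l, hl, hl'⟩, ⟨r, hr, hr'⟩⟩ := hbc
    have hc := (hw.ac_weak hi).continuousOn
    rw [uIcc_of_le hle] at hc
    refine ⟨⟨l * G (w (-1)), ?_, hl.mul ((hG.tendsto _).comp ?_)⟩,
      ⟨r * G (w 1), ?_, hr.mul ((hG.tendsto _).comp ?_)⟩⟩
    · rcases le_or_gt 0 (w (-1)) with h | h
      · simp [hG1 _ h]
      · exact mul_nonpos_of_nonpos_of_nonneg (nonpos_of_robin hβ hβ' hl' h) (hG0 _)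
    · exact (hc (-1) (left_mem_Icc.2 hle)).mono_of_mem_nhdsWithin
        (mem_of_superset (Ioo_mem_nhdsGT (show (-1 : ℝ) < 1 by norm_num)) Ioo_subset_Icc_self)
    · rcases le_or_gt 0 (w 1) with h | h
      · simp [hG1 _ h]
      · refine mul_nonneg ?_ (hG0 _)
        -- The reflection x ↦ -x reverses the sign of the flux and reduces the right endpoint to the
        -- left one.
        have := nonpos_of_robin (β₀ := γ₀) (β₁ := -γ₁) (l := -r) (wl := w 1)
          (by simpa using hγ) (by linarith) (by linarith) h
        linarith
    · exact (hc 1 (right_mem_Icc.2 hle)).mono_of_mem_nhdsWithin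
        (mem_of_superset (Ioo_mem_nhdsLT (show (-1 : ℝ) < 1 by norm_num)) Ioo_subset_Icc_self)
  | neumann =>
    -- Here w may be unbounded near ±1; boundedness of G makes the product vanish.
    have key : ∀ F : Filter ℝ, Tendsto (flux a w) F (𝓝 0) →
        Tendsto (fun x => flux a w x * G (w x)) F (𝓝 0) := fun F hF =>
      hF.zero_mul_isBoundedUnder_le (isBoundedUnder_of ⟨M, fun x => hM _⟩)
    exact ⟨⟨0, le_rfl, key _ hbc.1⟩, ⟨0, le_rfl, key _ hbc.2⟩⟩

theorem lipschitzWith_negPart_min (n : ℝ) : LipschitzWith 1 fun s : ℝ => min (max (-s) 0) n :=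
  (LipschitzWith.id.neg.max_const 0).min_const n

theorem memLp_negPart {X : Type*} [MeasurableSpace X] {μ : Measure X} {w : X → ℝ}
    (hw : MemLp w 2 μ) : MemLp (fun x => max (-w x) 0) 2 μ := by
  refine hw.of_le ((continuous_neg.max continuous_const).comp_aestronglyMeasurable
    hw.aestronglyMeasurable) (Eventually.of_forall fun x => ?_)
  rw [Real.norm_eq_abs, Real.norm_eq_abs, abs_of_nonneg (le_max_right _ _)]
  exact max_le (neg_le_abs _) (abs_nonneg _)

/-- The spatial operator is dissipative on negative parts. -/
theorem integral_deriv_flux_mul_negPart_nonneg {a w : ℝ → ℝ} {ϑ : ℝ} {bc : BoundaryCondition}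
    (hdeg : Deg a ϑ bc) (hw : MemH2a a w) (hbc : bc.Holds a w) :
    Integrable (fun x => deriv (flux a w) x * max (-w x) 0) spaceMeasure ∧
      0 ≤ ∫ x, deriv (flux a w) x * max (-w x) 0 ∂spaceMeasure := by
  obtain ⟨hw1, p, hp, hp', hpf⟩ := hw
  have hflux := flux_eq_of_ae_eq hdeg.continuousOn hdeg.pos hw1.locallyAC hp hpf
  have hder : deriv (flux a w) =ᵐ[spaceMeasure] deriv p := by
    refine ae_restrict_of_forall_mem measurableSet_Ioo fun x hx => ?_
    have : flux a w =ᶠ[𝓝 x] p := eventually_of_mem (isOpen_Ioo.mem_nhds hx) hflux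
    exact this.deriv_eq
  have hmeas : AEStronglyMeasurable w spaceMeasure := hw1.memLp.aestronglyMeasurable
  have hneg := memLp_negPart hw1.memLp
  have hint : Integrable (fun x => deriv p x * max (-w x) 0) spaceMeasure :=
    hp'.integrable_mul hneg
  have hcongr : (fun x => deriv (flux a w) x * max (-w x) 0) =ᵐ[spaceMeasure]
      fun x => deriv p x * max (-w x) 0 := by
    filter_upwards [hder] with x hx
    rw [hx]
  refine ⟨hint.congr hcongr.symm, ?_⟩
  rw [integral_congr_ae hcongr]
  -- The negative part may be unbounded, so it is truncated at height n; dominated convergence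
  -- removes the truncation.
  have hlim : Tendsto (fun n : ℕ => ∫ x, deriv p x * min (max (-w x) 0) n ∂spaceMeasure) atTop
      (𝓝 (∫ x, deriv p x * max (-w x) 0 ∂spaceMeasure)) := by
    refine tendsto_integral_of_dominated_convergence _ (fun n => ?_) hint.norm
      (fun n => Eventually.of_forall fun x => ?_) (Eventually.of_forall fun x => ?_)
    · exact hp'.aestronglyMeasurable.mul
        ((lipschitzWith_negPart_min n).continuous.comp_aestronglyMeasurable hmeas)
    · rw [norm_mul, norm_mul]
      have h1 : 0 ≤ min (max (-w x) 0) (n : ℝ) := le_min (le_max_right _ _) n.cast_nonneg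
      rw [Real.norm_of_nonneg h1, Real.norm_of_nonneg (le_max_right _ _)]
      exact mul_le_mul_of_nonneg_left (min_le_left _ _) (norm_nonneg _)
    · obtain ⟨N, hN⟩ := exists_nat_ge (max (-w x) 0)
      refine tendsto_const_nhds.congr' (eventually_atTop.2 ⟨N, fun n hn => ?_⟩)
      simp only [min_eq_left (hN.trans (Nat.cast_le.2 hn))]
  refine ge_of_tendsto' hlim fun n => ?_
  have hGM : ∀ s : ℝ, |min (max (-s) 0) (n : ℝ)| ≤ n := fun s => by
    rw [abs_of_nonneg (le_min (le_max_right _ _) n.cast_nonneg)]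
    exact min_le_right _ _
  obtain ⟨⟨l, hl0, hl⟩, ⟨r, hr0, hr⟩⟩ := hbc.boundary_terms hdeg hw1
    (lipschitzWith_negPart_min n).continuous hGM
    (fun s => le_min (le_max_right _ _) n.cast_nonneg)
    (fun s hs => by rw [max_eq_right (by linarith), min_eq_left n.cast_nonneg])
  refine integral_deriv_mul_comp_nonneg hdeg.pos hw1.locallyAC hp hflux
    (lipschitzWith_negPart_min n) (fun s t hst => ?_) hGM hl hl0 hr hr0
  exact min_le_min_right _ (max_le_max_right _ (neg_le_neg hst))

/-! ### The energy identity in time and Grönwall's inequality. -/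

theorem cylMeasure_eq_prod (T : ℝ) : cylMeasure T = spaceMeasure.prod (timeMeasure T) := by
  rw [cylMeasure, Measure.volume_eq_prod, Measure.prod_restrict]

theorem hasDerivAt_negPart_sq (s : ℝ) :
    HasDerivAt (fun s : ℝ => max (-s) 0 ^ 2) (-2 * max (-s) 0) s := by
  rcases lt_trichotomy s 0 with h | rfl | h
  · have h1 : HasDerivAt (fun s : ℝ => s ^ 2) (2 * s) s := by simpa using hasDerivAt_pow 2 s
    rw [max_eq_left (by linarith)]
    rw [show -2 * -s = 2 * s by ring]
    refine h1.congr_of_eventuallyEq ?_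
    filter_upwards [Iio_mem_nhds h] with y hy
    rw [max_eq_left (by simpa using hy.le), neg_sq]
  · rw [hasDerivAt_iff_isLittleO]
    simp only [neg_zero, max_self, mul_zero, sub_zero, smul_zero, ne_eq, OfNat.ofNat_ne_zero,
      not_false_eq_true, zero_pow]
    refine Asymptotics.IsBigO.trans_isLittleO (g := fun x : ℝ => x ^ 2) ?_
      (Asymptotics.isLittleO_pow_id one_lt_two)
    refine Asymptotics.IsBigO.of_bound 1 (Eventually.of_forall fun x => ?_)
    rw [one_mul, norm_pow, norm_pow, Real.norm_of_nonneg (le_max_right _ _), Real.norm_eq_abs]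
    exact pow_le_pow_left₀ (le_max_right _ _) (max_le (neg_le_abs _) (abs_nonneg _)) 2
  · rw [max_eq_right (by linarith), mul_zero]
    refine (hasDerivAt_const s (0 : ℝ)).congr_of_eventuallyEq ?_
    filter_upwards [Ioi_mem_nhds h] with y hy
    rw [max_eq_right (by simpa using hy.le)]
    norm_num

/-- The squared negative part of an absolutely continuous function is absolutely continuous. Since s
↦ (s⁻)² is differentiable even at 0, the chain rule holds wherever the primitive is differentiable.
-/
theorem negPart_sq_sub_eq_integral {h : ℝ → ℝ} {t : ℝ} (c : ℝ)
    (hh : IntervalIntegrable h volume 0 t) :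
    max (-(c + ∫ r in (0 : ℝ)..t, h r)) 0 ^ 2 - max (-c) 0 ^ 2 =
      ∫ s in (0 : ℝ)..t, -2 * max (-(c + ∫ r in (0 : ℝ)..s, h r)) 0 * h s := by
  have hconst : AbsolutelyContinuousOnInterval (fun _ : ℝ => c) 0 t :=
    (LipschitzWith.const c : LipschitzWith 0 fun _ : ℝ => c).lipschitzOnWith.absolutelyContinuousOnInterval
  have hac := (hconst.fun_add (hh.absolutelyContinuousOnInterval_intervalIntegral
    (c := 0) left_mem_uIcc)).lipschitz_comp (G := fun s => max (-s) 0)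
    (LipschitzWith.id.neg.max_const 0)
  have hac2 := (hac.fun_mul hac).integral_deriv_eq_sub
  simp only [← pow_two, intervalIntegral.integral_same, add_zero] at hac2
  rw [← hac2]
  refine intervalIntegral.integral_congr_ae ?_
  filter_upwards [hh.ae_hasDerivAt_integral] with s hs hs'
  have h1 := (hs (uIoc_subset_uIcc hs') 0 left_mem_uIcc).const_add c
  exact ((hasDerivAt_negPart_sq _).comp s h1).deriv

/-- A jointly measurable time derivative makes its primitive jointly measurable, as Fubini's theorem
requires. -/
theorem IsTimeDeriv.exists_stronglyMeasurable {T : ℝ} {u ut : ℝ → ℝ → ℝ}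
    (h : IsTimeDeriv T u ut) : ∃ vt : ℝ → ℝ → ℝ, StronglyMeasurable (Function.uncurry vt) ∧
      Function.uncurry ut =ᵐ[cylMeasure T] Function.uncurry vt ∧ IsTimeDeriv T u vt := by
  obtain ⟨hL, hu⟩ := h
  have hae := hL.aestronglyMeasurable.ae_eq_mk
  refine ⟨Function.curry (hL.aestronglyMeasurable.mk _), ?_, ?_, ?_, fun t ht => ?_⟩
  · simpa using hL.aestronglyMeasurable.stronglyMeasurable_mk
  · simpa using hae
  · simpa using hL.ae_eq hae
  · have hae' : ∀ᵐ p ∂(spaceMeasure.prod (timeMeasure T)), Function.uncurry ut p =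
        hL.aestronglyMeasurable.mk (Function.uncurry ut) p := by
      rw [← cylMeasure_eq_prod]
      exact hae
    filter_upwards [hu t ht, Measure.ae_ae_of_ae_prod hae'] with x hx hx'
    rw [hx]
    congr 1
    refine intervalIntegral.integral_congr_ae ?_
    have h2 := (ae_restrict_iff' measurableSet_Ioo).1 hx'
    filter_upwards [h2, compl_mem_ae_iff.2 (measure_singleton T)] with s hs hsT hs'
    rw [uIoc_of_le ht.1] at hs'
    exact hs ⟨hs'.1, lt_of_le_of_ne (hs'.2.trans ht.2) hsT⟩

/-- The indicator moves the variable endpoint into the integrand, leaving a parameter integral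
against a fixed measure. -/
theorem stronglyMeasurable_primitive {g : ℝ → ℝ} {h : ℝ → ℝ → ℝ} (hg : StronglyMeasurable g)
    (hh : StronglyMeasurable (Function.uncurry h)) :
    StronglyMeasurable fun p : ℝ × ℝ => g p.1 + ∫ r, (Ioc 0 p.2).indicator (h p.1) r := by
  refine (hg.comp_measurable measurable_fst).add
    (StronglyMeasurable.integral_prod_right' (f := fun q : (ℝ × ℝ) × ℝ =>
      (Ioc 0 q.1.2).indicator (h q.1.1) q.2) ?_)
  have hS : MeasurableSet {q : (ℝ × ℝ) × ℝ | 0 < q.2 ∧ q.2 ≤ q.1.2} :=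
    (measurableSet_lt measurable_const measurable_snd).inter
      (measurableSet_le measurable_snd (measurable_snd.comp measurable_fst))
  have h1 : StronglyMeasurable fun q : (ℝ × ℝ) × ℝ => h q.1.1 q.2 :=
    hh.comp_measurable ((measurable_fst.comp measurable_fst).prodMk measurable_snd)
  exact h1.indicator hS

/-- The exceptional null set of x depends on s; joint measurability lets Tonelli's theorem handle
this. -/
theorem ae_cylMeasure_eq_zero {T : ℝ} {h : ℝ × ℝ → ℝ}
    (hh : AEStronglyMeasurable h (cylMeasure T))
    (h0 : ∀ s ∈ Icc 0 T, ∀ᵐ x ∂spaceMeasure, h (x, s) = 0) : ∀ᵐ p ∂cylMeasure T, h p = 0 := by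
  rw [cylMeasure_eq_prod] at hh ⊢
  have hint : ∫⁻ p, ‖h p‖ₑ ∂(spaceMeasure.prod (timeMeasure T)) = 0 := by
    rw [lintegral_prod_symm _ hh.enorm]
    refine (lintegral_congr_ae (g := 0) ?_).trans (by simp)
    refine ae_restrict_of_forall_mem measurableSet_Ioo fun s hs => ?_
    refine (lintegral_congr_ae (g := 0) ?_).trans (by simp)
    filter_upwards [h0 s (Ioo_subset_Icc_self hs)] with x hx
    simp [hx]
  rw [lintegral_eq_zero_iff' hh.enorm] at hint
  filter_upwards [hint] with p hp
  simpa using hp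

/-- The energy identity for the negative part. -/
theorem IsTimeDeriv.energy_identity {T : ℝ} {u ut : ℝ → ℝ → ℝ}
    (hu : IsTimeDeriv T u ut) (hut : StronglyMeasurable (Function.uncurry ut))
    (hL2 : MemLp (Function.uncurry u) 2 (cylMeasure T))
    (hsec : ∀ t ∈ Icc 0 T, MemLp (fun x => u x t) 2 spaceMeasure) :
    Integrable (fun p : ℝ × ℝ => -2 * max (-u p.1 p.2) 0 * ut p.1 p.2) (cylMeasure T) ∧
    ∀ t ∈ Icc 0 T, ∫ x, max (-u x t) 0 ^ 2 ∂spaceMeasure = ∫ x, max (-u x 0) 0 ^ 2 ∂spaceMeasure +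
      ∫ s in (0 : ℝ)..t, ∫ x, -2 * max (-u x s) 0 * ut x s ∂spaceMeasure := by
  have hF : Integrable (fun p : ℝ × ℝ => -2 * max (-u p.1 p.2) 0 * ut p.1 p.2) (cylMeasure T) := by
    have := ((memLp_negPart hL2).integrable_mul hu.1).const_mul (-2)
    refine this.congr (Eventually.of_forall fun p => ?_)
    simp [Function.uncurry, mul_assoc]
  refine ⟨hF, fun t ht => ?_⟩
  have h0T : (0 : ℝ) ∈ Icc 0 T := ⟨le_rfl, ht.1.trans ht.2⟩
  have hm0 := (hsec 0 h0T).aestronglyMeasurable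
  set g := hm0.mk _ with hg
  have hV := stronglyMeasurable_primitive hm0.stronglyMeasurable_mk hut
  -- For a.e. fixed x, V is absolutely continuous in time, whereas u agrees with it only up to a
  -- null set of x depending on the time. The chain rule and the swap of integrals are carried out
  -- for V.
  set V : ℝ × ℝ → ℝ := fun p => g p.1 + ∫ r, (Ioc 0 p.2).indicator (ut p.1) r with hVdef
  have hVs : ∀ x s, 0 ≤ s → V (x, s) = g x + ∫ r in (0 : ℝ)..s, ut x r := by
    intro x s hs
    simp only [hVdef]
    rw [integral_indicator measurableSet_Ioc, intervalIntegral.integral_of_le hs]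
  have huV : ∀ s ∈ Icc 0 T, ∀ᵐ x ∂spaceMeasure, u x s = V (x, s) := by
    intro s hs
    filter_upwards [hu.2 s hs, hm0.ae_eq_mk] with x hx hx'
    rw [hVs x s hs.1, hx, hg, ← hx']
  have huV' : ∀ᵐ p ∂cylMeasure T, u p.1 p.2 = V p := by
    have := ae_cylMeasure_eq_zero (hL2.aestronglyMeasurable.sub hV.aestronglyMeasurable) (T := T)
      fun s hs => (huV s hs).mono fun x hx => sub_eq_zero.2 hx
    exact this.mono fun p hp => sub_eq_zero.1 hp
  have hFV : Integrable (fun p : ℝ × ℝ => -2 * max (-V p) 0 * ut p.1 p.2) (cylMeasure T) := by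
    refine hF.congr ?_
    filter_upwards [huV'] with p hp
    rw [hp]
  have hle : timeMeasure T = volume.restrict (Ioc 0 T) := restrict_Ioo_eq_restrict_Ioc
  have hFt : Integrable (fun p : ℝ × ℝ => -2 * max (-V p) 0 * ut p.1 p.2)
      (spaceMeasure.prod (volume.restrict (Ioc 0 t))) := by
    rw [cylMeasure_eq_prod, hle] at hFV
    exact hFV.mono_measure (Measure.prod_mono le_rfl
      (Measure.restrict_mono (Ioc_subset_Ioc_right ht.2) le_rfl))
  have huti : ∀ᵐ x ∂spaceMeasure, IntervalIntegrable (ut x) volume 0 t := by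
    have : IsFiniteMeasure (cylMeasure T) := by
      rw [cylMeasure_eq_prod]; infer_instance
    have := hu.1.integrable (by norm_num)
    rw [cylMeasure_eq_prod, hle] at this
    filter_upwards [this.prod_right_ae] with x hx
    rw [intervalIntegrable_iff_integrableOn_Ioc_of_le ht.1]
    exact IntegrableOn.mono_set (s := Ioc 0 t) (t := Ioc 0 T) hx (Ioc_subset_Ioc_right ht.2)
  have hpt : ∀ᵐ x ∂spaceMeasure, max (-u x t) 0 ^ 2 - max (-u x 0) 0 ^ 2 =
      ∫ s in Ioc 0 t, -2 * max (-V (x, s)) 0 * ut x s := by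
    filter_upwards [huti, huV t ht, huV 0 h0T] with x hx h1 h2
    have h3 := negPart_sq_sub_eq_integral (g x) hx
    rw [h1, h2, hVs x t ht.1, hVs x 0 le_rfl, intervalIntegral.integral_same, add_zero, h3,
      intervalIntegral.integral_of_le ht.1]
    refine setIntegral_congr_fun measurableSet_Ioc fun s hs => ?_
    simp only [hVs x s hs.1.le]
  have hsq : ∀ s ∈ Icc 0 T, Integrable (fun x => max (-u x s) 0 ^ 2) spaceMeasure := fun s hs =>
    (memLp_negPart (hsec s hs)).integrable_sq
  have hsub := integral_congr_ae hpt
  rw [integral_sub (hsq t ht) (hsq 0 h0T), integral_integral_swap hFt,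
    ← intervalIntegral.integral_of_le ht.1] at hsub
  rw [← sub_eq_iff_eq_add', hsub]
  refine intervalIntegral.integral_congr fun s hs => ?_
  rw [uIcc_of_le ht.1] at hs
  refine integral_congr_ae ?_
  filter_upwards [huV s ⟨hs.1, hs.2.trans ht.2⟩] with x hx
  rw [hx]

/-- Grönwall's inequality for an absolutely continuous function. -/
theorem le_exp_mul_of_integral {E D : ℝ → ℝ} {C T : ℝ} (hD : IntervalIntegrable D volume 0 T)
    (hE : ∀ t ∈ Icc 0 T, E t = E 0 + ∫ s in (0 : ℝ)..t, D s)
    (hDE : ∀ᵐ s ∂timeMeasure T, D s ≤ C * E s) {t : ℝ} (ht : t ∈ Icc 0 T) :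
    E t ≤ Real.exp (C * t) * E 0 := by
  have hDt : IntervalIntegrable D volume 0 t := hD.mono_set (by
    rw [uIcc_of_le ht.1, uIcc_of_le (ht.1.trans ht.2)]
    exact Icc_subset_Icc_right ht.2)
  have hconst : AbsolutelyContinuousOnInterval (fun _ : ℝ => E 0) 0 t :=
    (LipschitzWith.const _ : LipschitzWith 0 fun _ : ℝ => E 0).lipschitzOnWith.absolutelyContinuousOnInterval
  -- Integrating factor: exp(-Cs) E(s) has a.e. nonpositive derivative.
  have hexp : AbsolutelyContinuousOnInterval (fun s : ℝ => Real.exp (-C * s)) 0 t :=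
    ContDiffOn.absolutelyContinuousOnInterval (by fun_prop)
  have hac := hexp.fun_mul (hconst.fun_add (hDt.absolutelyContinuousOnInterval_intervalIntegral
    (c := 0) left_mem_uIcc))
  have h1 := hac.integral_deriv_eq_sub
  rw [← hE t ht] at h1
  simp only [intervalIntegral.integral_same, mul_zero, Real.exp_zero, one_mul, add_zero] at h1
  have h2 : ∫ s in (0 : ℝ)..t,
      deriv (fun s => Real.exp (-C * s) * (E 0 + ∫ r in (0 : ℝ)..s, D r)) s ≤ 0 := by
    rw [intervalIntegral.integral_of_le ht.1, integral_Ioc_eq_integral_Ioo]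
    refine integral_nonpos_of_ae ?_
    have h3 := (ae_restrict_iff' measurableSet_Ioo).1 hDE
    refine (ae_restrict_iff' measurableSet_Ioo).2 ?_
    filter_upwards [hDt.ae_hasDerivAt_integral, h3] with s hs hs2 hs'
    have hsm : s ∈ uIcc 0 t := by rw [uIcc_of_le ht.1]; exact Ioo_subset_Icc_self hs'
    have hd1 := (hs hsm 0 left_mem_uIcc).const_add (E 0)
    have hd2 : HasDerivAt (fun s : ℝ => Real.exp (-C * s)) (Real.exp (-C * s) * (-C)) s := by
      simpa using ((hasDerivAt_id s).const_mul (-C)).exp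
    rw [(hd2.fun_mul hd1).deriv, ← hE s ⟨hs'.1.le, hs'.2.le.trans ht.2⟩]
    have := hs2 ⟨hs'.1, hs'.2.trans_le ht.2⟩
    have he := Real.exp_pos (-C * s)
    simp only [Pi.zero_apply]
    nlinarith
  have h4 : Real.exp (-C * t) * E t ≤ E 0 := by linarith
  have h5 := mul_le_mul_of_nonneg_left h4 (Real.exp_pos (C * t)).le
  rwa [← mul_assoc, ← Real.exp_add, show C * t + -C * t = 0 by ring, Real.exp_zero, one_mul] at h5

/-! ### Bounds on the reaction terms and the estimate for strict solutions. -/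

theorem ae_time_ae_space {T : ℝ} {P : ℝ × ℝ → Prop} (h : ∀ᵐ p ∂cylMeasure T, P p) :
    ∀ᵐ t ∂timeMeasure T, ∀ᵐ x ∂spaceMeasure, P (x, t) := by
  rw [cylMeasure_eq_prod] at h
  exact Measure.ae_ae_of_ae_prod (Measure.measurePreserving_swap.quasiMeasurePreserving.ae h)

theorem ae_cylMeasure_of_ae_space {T : ℝ} {P : ℝ → Prop} (h : ∀ᵐ x ∂spaceMeasure, P x) :
    ∀ᵐ p ∂cylMeasure T, P p.1 := by
  rw [cylMeasure_eq_prod]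
  exact Measure.quasiMeasurePreserving_fst.ae h

theorem PiecewiseStatic.exists_bound {α : ℝ → ℝ → ℝ} {T : ℝ} (h : PiecewiseStatic α T)
    (hT : 0 < T) : ∃ K, 0 ≤ K ∧ ∀ᵐ p ∂cylMeasure T, |α p.1 p.2| ≤ K := by
  obtain ⟨m, τ, A, h0, hm, -, hA, hα⟩ := h
  -- For m = 0 nothing would bound `A 0`; T > 0 excludes this.
  have hm0 : 0 < m := by
    rcases Nat.eq_zero_or_pos m with rfl | h
    · exact absurd (h0.symm.trans hm) hT.ne
    · exact h
  have hAb : ∀ k, ∃ C, 0 ≤ C ∧ (k < m → ∀ᵐ x ∂spaceMeasure, |A k x| ≤ C) := by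
    intro k
    by_cases hk : k < m
    · have hk' := hA k hk
      refine ⟨(eLpNorm (A k) ∞ spaceMeasure).toReal, ENNReal.toReal_nonneg, fun _ => ?_⟩
      have h1 := ae_le_eLpNormEssSup (f := A k) (μ := spaceMeasure)
      rw [← eLpNorm_exponent_top] at h1
      filter_upwards [h1] with x hx
      have := ENNReal.toReal_mono hk'.eLpNorm_ne_top hx
      simpa using this
    · exact ⟨0, le_rfl, fun h => absurd h hk⟩
  choose C hC0 hC using hAb
  refine ⟨C 0 + ∑ k ∈ Finset.Ico 1 m, C k,
    add_nonneg (hC0 0) (Finset.sum_nonneg fun k _ => hC0 k), ?_⟩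
  have hall : ∀ᵐ x ∂spaceMeasure, ∀ k, k < m → |A k x| ≤ C k := by
    rw [ae_all_iff]
    intro k
    by_cases hk : k < m
    · exact (hC k hk).mono fun x hx _ => hx
    · exact Eventually.of_forall fun x h => absurd h hk
  have hind : ∀ (S : Set ℝ) (c t : ℝ), |c * S.indicator (1 : ℝ → ℝ) t| ≤ |c| := by
    intro S c t
    by_cases ht : t ∈ S <;> simp [ht]
  filter_upwards [hα, ae_cylMeasure_of_ae_space hall] with p hp hAp
  rw [hp]
  refine (abs_add_le _ _).trans (add_le_add ((hind _ _ _).trans (hAp 0 hm0))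
    ((Finset.abs_sum_le_sum_abs _ _).trans (Finset.sum_le_sum fun k hk => ?_)))
  exact (hind _ _ _).trans (hAp k (Finset.mem_Ico.1 hk).2)

/-- The growth bound with ϑ > 0 forces f = 0 at u = 0; then take v = 0 in the one-sided condition.
-/
theorem SL.ae_mul_self_le {f : ℝ → ℝ → ℝ → ℝ} {T ϑ δ ν : ℝ} (hf : SL f T ϑ δ ν) (hϑ : 1 ≤ ϑ) :
    ∀ᵐ p ∂cylMeasure T, ∀ u, f p.1 p.2 u * u ≤ ν * u ^ 2 := by
  filter_upwards [hf.growth, hf.oneSided] with p h1 h2 u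
  have h0 : f p.1 p.2 0 = 0 := by
    have := h1 0
    rw [abs_zero, Real.zero_rpow (by linarith), mul_zero] at this
    exact abs_eq_zero.1 (le_antisymm this (abs_nonneg _))
  simpa [h0] using (h2 u 0).2

theorem neg_two_mul_negPart_mul_le {K ν α w f wt F : ℝ} (hK : |α| ≤ K) (hf : f * w ≤ ν * w ^ 2)
    (heq : wt - F = α * w + f) :
    -2 * max (-w) 0 * wt ≤ 2 * (K + ν) * max (-w) 0 ^ 2 - 2 * (F * max (-w) 0) := by
  obtain rfl : wt = F + (α * w + f) := by linarith
  rcases le_total w 0 with h | h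
  · rw [max_eq_left (by linarith)]
    have := mul_le_mul_of_nonneg_right ((le_abs_self α).trans hK) (sq_nonneg w)
    nlinarith
  · rw [max_eq_right (by linarith)]
    simp

/-- The energy estimate for the negative part of a strict solution. -/
theorem IsStrictSolution.integral_negPart_sq_le {a : ℝ → ℝ} {bc : BoundaryCondition}
    {T ϑ δ ν K : ℝ} {α : ℝ → ℝ → ℝ} {f : ℝ → ℝ → ℝ → ℝ} {w₀ : ℝ → ℝ} {w : ℝ → ℝ → ℝ}
    (hT : 0 < T) (hdeg : Deg a ϑ bc) (hf : SL f T ϑ δ ν)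
    (hα : ∀ᵐ p ∂cylMeasure T, |α p.1 p.2| ≤ K) (hw : IsStrictSolution a bc T α f w₀ w)
    {t : ℝ} (ht : t ∈ Icc 0 T) :
    ∫ x, max (-w x t) 0 ^ 2 ∂spaceMeasure ≤
      Real.exp (2 * (K + ν) * t) * ∫ x, max (-w x 0) 0 ^ 2 ∂spaceMeasure := by
  obtain ⟨ut, hut, heq⟩ := hw.equation
  obtain ⟨wt, hwm, hae, hwt⟩ := hut.exists_stronglyMeasurable
  have hsec : ∀ t ∈ Icc 0 T, MemLp (fun x => w x t) 2 spaceMeasure := fun t ht =>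
    (hw.memH.memH1a t ht).memLp
  obtain ⟨hF, hE⟩ := hwt.energy_identity hwm hw.memH.memLp hsec
  rw [cylMeasure_eq_prod] at hF
  refine le_exp_mul_of_integral (E := fun t => ∫ x, max (-w x t) 0 ^ 2 ∂spaceMeasure) ?_ hE ?_ ht
  · rw [intervalIntegrable_iff_integrableOn_Ioo_of_le hT.le]
    exact hF.integral_prod_right
  · have hpt : ∀ᵐ p ∂cylMeasure T, -2 * max (-w p.1 p.2) 0 * wt p.1 p.2 ≤
        2 * (K + ν) * max (-w p.1 p.2) 0 ^ 2 -
          2 * (deriv (flux a fun y => w y p.2) p.1 * max (-w p.1 p.2) 0) := by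
      filter_upwards [heq, hae, hα, hf.ae_mul_self_le hdeg.one_le] with p h1 h2 h3 h4
      refine neg_two_mul_negPart_mul_le h3 (h4 _) (h1 ▸ ?_)
      simpa [Function.uncurry] using h2.symm
    filter_upwards [ae_time_ae_space hpt, hw.boundary, hw.memH.memDA0, hF.prod_left_ae,
      ae_restrict_mem measurableSet_Ioo] with s hs hbc hDA hFs hsT
    obtain ⟨hi, hpos⟩ := integral_deriv_flux_mul_negPart_nonneg hdeg hDA.1 hbc
    have hsq := (memLp_negPart (hsec s (Ioo_subset_Icc_self hsT))).integrable_sq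
    have := integral_mono_ae hFs ((hsq.const_mul (2 * (K + ν))).sub (hi.const_mul 2)) hs
    refine this.trans ?_
    simp only [Pi.sub_apply]
    rw [integral_sub (hsq.const_mul _) (hi.const_mul 2), integral_const_mul, integral_const_mul]
    linarith

/-! ### Passage from strict to strong solutions. -/

theorem toReal_eLpNorm_sq {g : ℝ → ℝ} (hg : MemLp g 2 spaceMeasure) :
    ∫ x, g x ^ 2 ∂spaceMeasure = (eLpNorm g 2 spaceMeasure ^ 2).toReal := by
  have h := eLpNorm_nnreal_pow_eq_lintegral (f := g) (μ := spaceMeasure) (p := 2) (by norm_num)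
  norm_num at h
  rw [h, integral_eq_lintegral_of_nonneg_ae (Eventually.of_forall fun x => sq_nonneg _)
    hg.integrable_sq.aestronglyMeasurable]
  congr 1
  refine lintegral_congr fun x => ?_
  rw [← enorm_pow, Real.enorm_of_nonneg (sq_nonneg _)]

/-- The supremum part of the norm alone gives L² convergence at every time. -/
theorem tendsto_integral_sq_sub {a : ℝ → ℝ} {T : ℝ} {u ux : ℝ → ℝ → ℝ} {v vx : ℕ → ℝ → ℝ → ℝ}
    (hu : ∀ t ∈ Icc 0 T, MemLp (fun x => u x t) 2 spaceMeasure)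
    (hv : ∀ k, ∀ t ∈ Icc 0 T, MemLp (fun x => v k x t) 2 spaceMeasure)
    (h : Tendsto (fun k => normBSq a T (fun x t => v k x t - u x t)
      (fun x t => vx k x t - ux x t)) atTop (𝓝 0)) {t : ℝ} (ht : t ∈ Icc 0 T) :
    Tendsto (fun k => ∫ x, (v k x t - u x t) ^ 2 ∂spaceMeasure) atTop (𝓝 0) := by
  have h1 : Tendsto (fun k => eLpNorm (fun x => v k x t - u x t) 2 spaceMeasure ^ 2)
      atTop (𝓝 0) := by
    refine tendsto_of_tendsto_of_tendsto_of_le_of_le tendsto_const_nhds h (fun k => zero_le)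
      fun k => le_trans ?_ le_self_add
    exact le_iSup₂ (f := fun t (_ : t ∈ Icc 0 T) =>
      eLpNorm (fun x => v k x t - u x t) 2 spaceMeasure ^ 2) t ht
  have h2 := (ENNReal.tendsto_toReal ENNReal.zero_ne_top).comp h1
  refine h2.congr fun k => ?_
  exact (toReal_eLpNorm_sq ((hv k t ht).sub (hu t ht))).symm

theorem negPart_sq_le (r s : ℝ) :
    max (-r) 0 ^ 2 ≤ 2 * max (-s) 0 ^ 2 + 2 * (s - r) ^ 2 := by
  rcases le_total r 0 with hr | hr <;> rcases le_total s 0 with hs | hs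
  · rw [max_eq_left (by linarith), max_eq_left (by linarith)]
    nlinarith [sq_nonneg (2 * s - r)]
  · rw [max_eq_left (by linarith), max_eq_right (by linarith)]
    nlinarith
  · rw [max_eq_right (by linarith), zero_pow two_ne_zero]
    positivity
  · rw [max_eq_right (by linarith), zero_pow two_ne_zero]
    positivity

theorem negPart_sq_le_sub_sq {r : ℝ} (hr : 0 ≤ r) (s : ℝ) : max (-s) 0 ^ 2 ≤ (s - r) ^ 2 := by
  rcases le_total s 0 with hs | hs
  · rw [max_eq_left (by linarith)]
    nlinarith
  · rw [max_eq_right (by linarith), zero_pow two_ne_zero]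
    positivity

theorem IsStrongSolution.ae_nonneg {a : ℝ → ℝ} {bc : BoundaryCondition} {T ϑ δ ν : ℝ}
    {α : ℝ → ℝ → ℝ} {f : ℝ → ℝ → ℝ → ℝ} {u₀ : ℝ → ℝ} {u : ℝ → ℝ → ℝ}
    (hT : 0 < T) (hdeg : Deg a ϑ bc) (hf : SL f T ϑ δ ν) (hα : PiecewiseStatic α T)
    (hu₀ : ∀ᵐ x ∂spaceMeasure, 0 ≤ u₀ x) (hu : IsStrongSolution a bc T α f u₀ u)
    {t : ℝ} (ht : t ∈ Icc 0 T) : ∀ᵐ x ∂spaceMeasure, 0 ≤ u x t := by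
  obtain ⟨-, hinit, ux, hB, uk, huk, hlim⟩ := hu
  obtain ⟨K, -, hK⟩ := hα.exists_bound hT
  have h0T : (0 : ℝ) ∈ Icc 0 T := ⟨le_rfl, hT.le⟩
  have hsec : ∀ k, ∀ t ∈ Icc 0 T, MemLp (fun x => uk k x t) 2 spaceMeasure := fun k t ht =>
    ((huk k).memH.memH1a t ht).memLp
  have hl0 := tendsto_integral_sq_sub hB.memL2 hsec hlim h0T
  have hlt := tendsto_integral_sq_sub hB.memL2 hsec hlim ht
  set e := Real.exp (2 * (K + ν) * t)
  have hneg := (memLp_negPart (hB.memL2 t ht)).integrable_sq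
  -- Compare u with uₖ at time t, apply the energy estimate to uₖ, and bound its initial negative
  -- part by |uₖ - u| at time 0, using u₀ ≥ 0. The right side tends to 0.
  have hbound : ∀ k, ∫ x, max (-u x t) 0 ^ 2 ∂spaceMeasure ≤
      2 * (e * ∫ x, (uk k x 0 - u x 0) ^ 2 ∂spaceMeasure) +
        2 * ∫ x, (uk k x t - u x t) ^ 2 ∂spaceMeasure := by
    intro k
    have hi0 : Integrable (fun x => (uk k x 0 - u x 0) ^ 2) spaceMeasure :=
      ((hsec k 0 h0T).sub (hB.memL2 0 h0T)).integrable_sq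
    have hit : Integrable (fun x => (uk k x t - u x t) ^ 2) spaceMeasure :=
      ((hsec k t ht).sub (hB.memL2 t ht)).integrable_sq
    have hkn := fun s hs => (memLp_negPart (hsec k s hs)).integrable_sq
    have h1 : ∫ x, max (-u x t) 0 ^ 2 ∂spaceMeasure ≤
        2 * ∫ x, max (-uk k x t) 0 ^ 2 ∂spaceMeasure +
          2 * ∫ x, (uk k x t - u x t) ^ 2 ∂spaceMeasure := by
      rw [← integral_const_mul, ← integral_const_mul,
        ← integral_add ((hkn t ht).const_mul 2) (hit.const_mul 2)]
      exact integral_mono hneg (((hkn t ht).const_mul 2).add (hit.const_mul 2))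
        fun x => negPart_sq_le _ _
    have h2 := (huk k).integral_negPart_sq_le hT hdeg hf hK ht
    have h3 : ∫ x, max (-uk k x 0) 0 ^ 2 ∂spaceMeasure ≤
        ∫ x, (uk k x 0 - u x 0) ^ 2 ∂spaceMeasure := by
      refine integral_mono_ae (hkn 0 h0T) hi0 ?_
      filter_upwards [hinit, hu₀] with x hx hx0
      exact negPart_sq_le_sub_sq (hx ▸ hx0) _
    have h4 := mul_le_mul_of_nonneg_left h3 (Real.exp_pos (2 * (K + ν) * t)).le
    linarith
  have hle : ∫ x, max (-u x t) 0 ^ 2 ∂spaceMeasure ≤ 0 := by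
    have hR := ((hl0.const_mul e).const_mul 2).add (hlt.const_mul 2)
    simp only [mul_zero, add_zero] at hR
    exact ge_of_tendsto' hR hbound
  have hzero := (integral_eq_zero_iff_of_nonneg (fun x => sq_nonneg _) hneg).1
    (le_antisymm hle (integral_nonneg fun x => sq_nonneg _))
  filter_upwards [hzero] with x hx
  have h5 : max (-u x t) 0 = 0 := pow_eq_zero_iff two_ne_zero |>.1 hx
  linarith [le_max_left (-u x t) 0]

end DegParabolic

theorem proposition1p1 (a : ℝ → ℝ) (bc : DegParabolic.BoundaryCondition) (T : ℝ) (hT : 0 < T)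
    (ϑ δ ν : ℝ) (f : ℝ → ℝ → ℝ → ℝ) (α : ℝ → ℝ → ℝ)
    (hdeg : DegParabolic.Deg a ϑ bc) (hf : DegParabolic.SL f T ϑ δ ν)
    (hα : DegParabolic.PiecewiseStatic α T)
    (u₀ : ℝ → ℝ) (hu₀ : MemLp u₀ 2 DegParabolic.spaceMeasure)
    (hu₀_nonneg : ∀ᵐ x ∂DegParabolic.spaceMeasure, 0 ≤ u₀ x)
    (u : ℝ → ℝ → ℝ) (hu : DegParabolic.IsStrongSolution a bc T α f u₀ u) :
    ∀ᵐ p ∂(DegParabolic.cylMeasure T), 0 ≤ u p.1 p.2 := by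
  have hmeas : MemLp (fun p : ℝ × ℝ => u p.1 p.2) 2 (DegParabolic.cylMeasure T) := by
    obtain ⟨-, -, ux, hB, -⟩ := hu
    exact hB.memLp
  have h := DegParabolic.ae_cylMeasure_eq_zero
    (DegParabolic.memLp_negPart hmeas).aestronglyMeasurable fun s hs =>
      (hu.ae_nonneg hT hdeg hf hα hu₀_nonneg hs).mono fun x hx => max_eq_right (by simpa using hx)
  filter_upwards [h] with p hp
  linarith [le_max_left (-u p.1 p.2) 0]
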